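/- Let $\alpha\ge 0$ and let $\mathcal E$ be the set of (classes of) measurable functions $r:[0,\infty)\to\mathbb R$ with $r(x)\in\{1,e^\alpha\}$ for almost every $x$, viewed as a subset of $L^\infty([0,\infty))$ with the weak-$\star$ topology $\sigma(L^\infty,L^1)$ and its Borel $\sigma$-algebra. For $r\in\mathcal E$ and $x\ge 0$ put $$e_x(r)=\limsup_{\varepsilon\to0^+}\frac1{|B(x,\varepsilon)|}\int_{B(x,\varepsilon)\cap[0,\infty)}r(y)\,dy ,$$ so that $e_x(r)=r(x)$ for almost every $x$. Let $\mu$ be any nonnegative Borel measure on $\mathcal E$ such that $\int_{\mathcal E}e_x(r)\,\mu(dr)=1$ for almost every $x\in[0,\infty)$ (such a $\mu$ automatically has total mass at most $1$), and let $q^{(\mu)}_x(dr)=e_x(r)\,\mu(dr)$ be the associated extremal $\alpha$-locally differentially private mechanism from $[0,\infty)$ to $\mathcal E$. For $\theta>0$ let $\widetilde P_\theta$ be the law on $\mathcal E$ of the public datum $Z$ when the private datum $X$ is uniform on $[0,\theta]$ and $Z\sim q^{(\mu)}_X$ given $X$, that is, $\widetilde P_\theta(A)=\frac1\theta\int_0^\theta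 q^{(\mu)}_x(A)\,dx$. Then for almost every $\theta_0\in(0,\infty)$ the model $(\widetilde P_\theta)_{\theta>0}$ is differentiable in quadratic mean at $\theta_0$: the $\widetilde P_\theta$ are probability measures dominated by $\mu$, and with $\widetilde p_\theta=d\widetilde P_\theta/d\mu$ there is a measurable score function $s_{\theta_0}:\mathcal E\to\mathbb R$ with $$\int_{\mathcal E}\Bigl(\sqrt{\widetilde p_{\theta_0+h}}-\sqrt{\widetilde p_{\theta_0}}-\tfrac12\,h\,s_{\theta_0}\sqrt{\widetilde p_{\theta_0}}\Bigr)^2d\mu=o(h^2)\qquad(h\to0).$$ Moreover, for almost every $\theta_0\in(0,\infty)$, the Fisher information (computed with any such score function) satisfies $$\mathcal I_{\theta_0}\bigl((\widetilde P_\theta)_\theta\bigr)=\int_{\mathcal E}s_{\theta_0}^2\,d\widetilde P_{\theta_0}\le\frac{(e^\alpha-1)^2}{\theta_0^2}.$$ -/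

import Mathlib

open MeasureTheory Set Filter Topology
open scoped ENNReal

noncomputable section

/-- Lebesgue measure on the half line `[0, ∞)`, the space of the private data, viewed as a measure
on `ℝ` carried by `[0, ∞)`. -/
def halfLine : Measure ℝ := volume.restrict (Ici 0)

/-- The set `ℰ` of (classes of) measurable functions `r` on `[0, ∞)` with `r x ∈ {1, exp α}` for
almost every `x`, inside `L^∞([0, ∞))`. It is a `def`, so that it does not inherit the norm topology
of `L^∞`: it carries the weak-⋆ topology defined below. -/
def ExtremalSet (α : ℝ) : Type :=
  {r : Lp ℝ ∞ halfLine // ∀ᵐ x ∂halfLine, r x = 1 ∨ r x = Real.exp α}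

namespace ExtremalSet

/-- The class in `L^∞([0, ∞))` underlying an element of `ℰ`. -/
def toLp {α : ℝ} (r : ExtremalSet α) : Lp ℝ ∞ halfLine := r.1

/-- The weak-⋆ topology `σ(L^∞, L¹)` on `ℰ`: the coarsest topology for which
`r ↦ ∫ r(x) u(x) dx` is continuous for every `u ∈ L¹([0, ∞))`. -/
instance instTopologicalSpace (α : ℝ) : TopologicalSpace (ExtremalSet α) :=
  TopologicalSpace.induced
    (fun (r : ExtremalSet α) (u : Lp ℝ 1 halfLine) => ∫ x, r.toLp x * u x ∂halfLine)
    Pi.topologicalSpace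

/-- The Borel `σ`-algebra of the weak-⋆ topology. -/
instance instMeasurableSpace (α : ℝ) : MeasurableSpace (ExtremalSet α) := borel (ExtremalSet α)

instance instBorelSpace (α : ℝ) : BorelSpace (ExtremalSet α) := ⟨rfl⟩

/-- The point evaluation
`e_x(r) = limsup_{ε → 0} |B(x, ε)|⁻¹ ∫_{B(x, ε) ∩ [0, ∞)} r(y) dy`,
which equals `r x` for almost every `x`. -/
def pointEval {α : ℝ} (x : ℝ) (r : ExtremalSet α) : ℝ :=
  limsup (fun ε : ℝ => (volume.real (Metric.ball x ε))⁻¹ *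
    ∫ y in Metric.ball x ε ∩ Ici 0, r.toLp y) (𝓝[>] 0)

/-- The normalization constraint on a nonnegative Borel measure `μ` on `ℰ`:
`∫ e_x(r) μ(dr) = 1` for almost every `x ∈ [0, ∞)`. -/
def IsNormalized {α : ℝ} (μ : Measure (ExtremalSet α)) : Prop :=
  ∀ᵐ x ∂halfLine, ∫⁻ r, ENNReal.ofReal (pointEval x r) ∂μ = 1

/-- The extremal mechanism `q^{(μ)}_x(dr) = e_x(r) μ(dr)` from `[0, ∞)` to `ℰ`. -/
def mechanism {α : ℝ} (μ : Measure (ExtremalSet α)) (x : ℝ) : Measure (ExtremalSet α) :=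
  μ.withDensity fun r => ENNReal.ofReal (pointEval x r)

end ExtremalSet

/-- The uniform law on `[0, θ]`, with Lebesgue density `θ⁻¹ 𝟙_{[0, θ]}`. -/
def uniformLaw (θ : ℝ) : Measure ℝ :=
  volume.withDensity fun x => ENNReal.ofReal ((Icc 0 θ).indicator (fun _ => 1 / θ) x)

/-- The law on `ℰ` of the public datum `Z` when `X` is uniform on `[0, θ]` and `Z ∼ q^{(μ)}_X`
given `X`, that is `A ↦ ∫ q^{(μ)}_x(A) P_θ(dx)`. -/
def privatizedLaw {α : ℝ} (μ : Measure (ExtremalSet α)) (θ : ℝ) : Measure (ExtremalSet α) :=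
  (uniformLaw θ).bind (ExtremalSet.mechanism μ)

/-- `s` is a score function at `θ₀` of the statistical model `(P_θ)_{θ ∈ Θ}`, `Θ ⊆ ℝ`, with
dominating measure `ν`: the model consists of probability measures dominated by `ν`, the point `θ₀`
is interior to `Θ`, the function `s` is measurable, and the densities `p_θ = dP_θ/dν` satisfy
`∫ (√p_{θ₀+h} - √p_{θ₀} - (1/2) h s √p_{θ₀})² dν = o(h²)` as `h → 0`. -/
structure IsScoreAt {Ω : Type*} [MeasurableSpace Ω] (P : ℝ → Measure Ω) (Θ : Set ℝ)
    (ν : Measure Ω) (θ₀ : ℝ) (s : Ω → ℝ) : Prop where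
  isProbabilityMeasure : ∀ θ ∈ Θ, IsProbabilityMeasure (P θ)
  absolutelyContinuous : ∀ θ ∈ Θ, P θ ≪ ν
  mem_interior : θ₀ ∈ interior Θ
  measurable : Measurable s
  isLittleO : ∀ ε : ℝ, 0 < ε → ∀ᶠ h in 𝓝 (0 : ℝ),
    ∫⁻ z, ENNReal.ofReal ((√((P (θ₀ + h)).rnDeriv ν z).toReal - √((P θ₀).rnDeriv ν z).toReal
      - 1 / 2 * h * s z * √((P θ₀).rnDeriv ν z).toReal) ^ 2) ∂ν ≤ ENNReal.ofReal (ε * h ^ 2)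

/-- Differentiability in quadratic mean at `θ₀`: existence of a score function. -/
def IsDQMAt {Ω : Type*} [MeasurableSpace Ω] (P : ℝ → Measure Ω) (Θ : Set ℝ)
    (ν : Measure Ω) (θ₀ : ℝ) : Prop :=
  ∃ s : Ω → ℝ, IsScoreAt P Θ ν θ₀ s

/-- The Fisher information `E_{θ₀}[s²]`, as an element of `[0, ∞]`, computed with the score `s`. -/
def fisherInformation {Ω : Type*} [MeasurableSpace Ω] (P : ℝ → Measure Ω) (θ₀ : ℝ)
    (s : Ω → ℝ) : ℝ≥0∞ :=
  ∫⁻ z, ENNReal.ofReal (s z ^ 2) ∂(P θ₀)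

end

/-! By Tonelli, the privatized law has `μ`-density `F_r(θ) / θ`, where `F_r(θ) = ∫_0^θ r`
(`privatizedLaw_eq_withDensity`). This average lies in `[1, exp α]` and is Lipschitz in `θ` near any
`θ₀ > 0`, uniformly in `r`; so is its square root. Each `F_r` is differentiable almost everywhere
with derivative `e_θ(r)`. Fubini turns this into: for almost every `θ₀`, `F_r` is differentiable at
`θ₀` for `μ`-almost every `r` (`ae_ae_hasDerivAt_primitive`). As `μ` is finite, dominated
convergence upgrades pointwise differentiability of the root densities to quadratic mean
(`tendsto_lintegral_sq_sub_div`). The score is `(e/p - 1) / θ₀` with `e` and `p` both in `[1, exp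
α]`, hence bounded by `(exp α - 1) / θ₀`. Any other score agrees with it almost surely
(`IsScoreAt.ae_eq`), so the bound on the information holds for all of them. -/

namespace ExtremalSet

variable {α : ℝ}

/-! ### Primitives: two-sided Lipschitz bounds and joint continuity. -/

/-- The primitive `t ↦ ∫_0^t r(y) dy` of the extension of `r` by zero to the real line. -/
noncomputable def primitive (r : ExtremalSet α) (t : ℝ) : ℝ :=
  ∫ y in (0 : ℝ)..t, (Ici (0 : ℝ)).indicator r.toLp y

theorem ae_mem (r : ExtremalSet α) :
    ∀ᵐ y, 0 ≤ y → r.toLp y = 1 ∨ r.toLp y = Real.exp α :=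
  (ae_restrict_iff' measurableSet_Ici).1 r.2

theorem ae_mem_Icc (hα : 0 ≤ α) (r : ExtremalSet α) :
    ∀ᵐ y, 0 ≤ y → r.toLp y ∈ Icc 1 (Real.exp α) := by
  filter_upwards [r.ae_mem] with y hy h0
  have := Real.one_le_exp hα
  rcases hy h0 with h | h <;> simp [h, this]

theorem ae_indicator_mem_Icc (hα : 0 ≤ α) (r : ExtremalSet α) :
    ∀ᵐ y, (Ici (0 : ℝ)).indicator r.toLp y ∈ Icc 0 (Real.exp α) := by
  filter_upwards [r.ae_mem_Icc hα] with y hy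
  by_cases h : 0 ≤ y
  · rw [indicator_of_mem (mem_Ici.2 h)]
    exact ⟨zero_le_one.trans (hy h).1, (hy h).2⟩
  · rw [indicator_of_notMem (by simpa using h)]
    exact ⟨le_rfl, (Real.exp_pos α).le⟩

theorem locallyIntegrable_indicator (hα : 0 ≤ α) (r : ExtremalSet α) :
    LocallyIntegrable ((Ici (0 : ℝ)).indicator r.toLp) volume := by
  have hm : AEStronglyMeasurable ((Ici (0 : ℝ)).indicator r.toLp) volume :=
    (aestronglyMeasurable_indicator_iff measurableSet_Ici).2 (Lp.aestronglyMeasurable r.toLp)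
  refine (locallyIntegrable_const (Real.exp α)).mono hm ?_
  filter_upwards [r.ae_indicator_mem_Icc hα] with y hy
  rw [Real.norm_of_nonneg hy.1, Real.norm_of_nonneg (Real.exp_pos α).le]
  exact hy.2

theorem intervalIntegrable_indicator (hα : 0 ≤ α) (r : ExtremalSet α) (a b : ℝ) :
    IntervalIntegrable ((Ici (0 : ℝ)).indicator r.toLp) volume a b :=
  intervalIntegrable_iff.2 ((LocallyIntegrable.integrableOn_isCompact
    (r.locallyIntegrable_indicator hα) isCompact_uIcc).mono_set uIoc_subset_uIcc)

theorem primitive_sub (hα : 0 ≤ α) (r : ExtremalSet α) (a b : ℝ) :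
    r.primitive b - r.primitive a = ∫ y in a..b, (Ici (0 : ℝ)).indicator r.toLp y :=
  intervalIntegral.integral_interval_sub_left (r.intervalIntegrable_indicator hα 0 b)
    (r.intervalIntegrable_indicator hα 0 a)

@[simp]
theorem primitive_zero (r : ExtremalSet α) : r.primitive 0 = 0 := by simp [primitive]

theorem primitive_sub_le (hα : 0 ≤ α) (r : ExtremalSet α) {a b : ℝ} (hab : a ≤ b) :
    r.primitive b - r.primitive a ≤ Real.exp α * (b - a) := by
  rw [r.primitive_sub hα]
  calc _ ≤ ∫ _ in a..b, Real.exp α :=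
        intervalIntegral.integral_mono_ae hab (r.intervalIntegrable_indicator hα a b)
          intervalIntegrable_const ((r.ae_indicator_mem_Icc hα).mono fun y hy => hy.2)
    _ = _ := by simp [mul_comm]

theorem monotone_primitive (hα : 0 ≤ α) (r : ExtremalSet α) : Monotone r.primitive := by
  intro a b hab
  rw [← sub_nonneg, r.primitive_sub hα]
  exact intervalIntegral.integral_nonneg_of_ae hab
    ((r.ae_indicator_mem_Icc hα).mono fun y hy => hy.1)

theorem le_primitive_sub (hα : 0 ≤ α) (r : ExtremalSet α) {a b : ℝ} (ha : 0 ≤ a) (hab : a ≤ b) :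
    b - a ≤ r.primitive b - r.primitive a := by
  rw [r.primitive_sub hα]
  calc b - a = ∫ _ in a..b, (1 : ℝ) := by simp
    _ ≤ _ := by
        refine intervalIntegral.integral_mono_ae_restrict hab intervalIntegrable_const
          (r.intervalIntegrable_indicator hα a b) ?_
        refine (ae_restrict_iff' measurableSet_Icc).2 ?_
        filter_upwards [r.ae_mem_Icc hα] with y hy h
        have h0 : 0 ≤ y := ha.trans h.1
        rw [indicator_of_mem (mem_Ici.2 h0)]
        exact (hy h0).1

theorem abs_primitive_sub_le (hα : 0 ≤ α) (r : ExtremalSet α) (a b : ℝ) :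
    |r.primitive b - r.primitive a| ≤ Real.exp α * |b - a| := by
  wlog hab : a ≤ b generalizing a b
  · rw [abs_sub_comm, abs_sub_comm b]
    exact this b a (le_of_not_ge hab)
  rw [abs_of_nonneg (sub_nonneg.2 (r.monotone_primitive hα hab)),
    abs_of_nonneg (sub_nonneg.2 hab)]
  exact r.primitive_sub_le hα hab

/-- For `t ≥ 0` this is the pairing of `r` with the `L¹` function `𝟙_{(0, t]}`, continuous by
definition of the weak-⋆ topology; for `t ≤ 0` it vanishes. -/
theorem continuous_primitive_right (t : ℝ) :
    Continuous fun r : ExtremalSet α => r.primitive t := by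
  rcases le_total 0 t with ht | ht
  · have hfin : halfLine (Ioc 0 t) ≠ ∞ := by
      refine ((Measure.restrict_apply_le _ _).trans_lt ?_).ne
      simp
    have key (r : ExtremalSet α) : r.primitive t =
        ∫ x, r.toLp x * indicatorConstLp 1 measurableSet_Ioc hfin (1 : ℝ) x ∂halfLine := by
      have h1 : ∫ x, r.toLp x * indicatorConstLp 1 measurableSet_Ioc hfin (1 : ℝ) x ∂halfLine
          = ∫ x, (Ioc 0 t).indicator r.toLp x ∂halfLine := by
        refine integral_congr_ae ?_
        filter_upwards [indicatorConstLp_coeFn (p := 1) (hs := measurableSet_Ioc)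
          (hμs := hfin) (c := (1 : ℝ))] with x hx
        rw [hx]
        by_cases h : x ∈ Ioc 0 t <;> simp [h]
      have h2 : halfLine.restrict (Ioc 0 t) = volume.restrict (Ioc 0 t ∩ Ici 0) :=
        Measure.restrict_restrict measurableSet_Ioc
      rw [h1, integral_indicator measurableSet_Ioc, h2, primitive,
        intervalIntegral.integral_of_le ht, setIntegral_indicator measurableSet_Ici]
    simp_rw [key]
    exact (continuous_pi_iff.1 (continuous_induced_dom (t := Pi.topologicalSpace)
      (f := fun (r : ExtremalSet α) (u : Lp ℝ 1 halfLine) => ∫ x, r.toLp x * u x ∂halfLine)))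
      (indicatorConstLp 1 measurableSet_Ioc hfin (1 : ℝ))
  · have key (r : ExtremalSet α) : r.primitive t = 0 := by
      rw [primitive, intervalIntegral.integral_of_ge ht, integral_Ioc_eq_integral_Ioo,
        setIntegral_eq_zero_of_forall_eq_zero, neg_zero]
      intro x hx
      exact indicator_of_notMem (by simpa using hx.2) _
    simp_rw [key]
    exact continuous_const

/-- Continuity in `r` at fixed `t` and a Lipschitz constant in `t` independent of `r` give joint
continuity, the source of all joint measurability below. -/
theorem continuous_uncurry_primitive (hα : 0 ≤ α) :
    Continuous (Function.uncurry (primitive (α := α))) := by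
  refine continuous_prod_of_continuous_lipschitzWith' _ (Real.toNNReal (Real.exp α)) (fun r => ?_)
    fun t => continuous_primitive_right t
  refine LipschitzWith.of_dist_le_mul fun a b => ?_
  rw [Real.coe_toNNReal _ (Real.exp_pos α).le]
  exact r.abs_primitive_sub_le hα b a

theorem continuous_primitive (hα : 0 ≤ α) (r : ExtremalSet α) : Continuous r.primitive :=
  (continuous_uncurry_primitive hα).comp (Continuous.prodMk_right r)

/-! ### Point evaluations as symmetric derivatives of the primitive. -/

theorem average_eq (hα : 0 ≤ α) (r : ExtremalSet α) (x : ℝ) {ε : ℝ} (hε : 0 < ε) :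
    (volume.real (Metric.ball x ε))⁻¹ * ∫ y in Metric.ball x ε ∩ Ici 0, r.toLp y =
      (2 * ε)⁻¹ * (r.primitive (x + ε) - r.primitive (x - ε)) := by
  rw [r.primitive_sub hα, intervalIntegral.integral_of_le (by linarith),
    integral_Ioc_eq_integral_Ioo, setIntegral_indicator measurableSet_Ici, Real.ball_eq_Ioo,
    Real.volume_real_Ioo_of_le (by linarith)]
  ring_nf

theorem pointEval_eq (hα : 0 ≤ α) (x : ℝ) (r : ExtremalSet α) :
    pointEval x r =
      limsup (fun ε : ℝ => (2 * ε)⁻¹ * (r.primitive (x + ε) - r.primitive (x - ε))) (𝓝[>] 0) :=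
  limsup_congr (eventually_mem_nhdsWithin.mono fun _ hε => r.average_eq hα x hε)

/-- The upper limit from the right of a function that is continuous on `(0, ∞)` may be taken along
the rational numbers. -/
theorem limsup_nhdsGT_zero_eq_rat {f : ℝ → ℝ} (hf : ContinuousOn f (Ioi 0)) :
    limsup f (𝓝[>] 0) =
      limsup (fun q : ℚ => f q) (comap ((↑) : ℚ → ℝ) (𝓝[>] (0 : ℝ))) := by
  rw [limsup_eq, limsup_eq]
  congr 1
  ext a
  simp only [mem_ofPred_eq]
  refine ⟨fun h => h.comap _, fun h => ?_⟩
  obtain ⟨t, ht, hta⟩ := mem_comap.1 h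
  obtain ⟨u, hu, hut⟩ := (mem_nhdsGT_iff_exists_Ioo_subset).1 ht
  refine mem_of_superset (Ioo_mem_nhdsGT hu) fun x hx => ?_
  by_contra hlt
  -- If `f` exceeded `a` at a real point, it would do so on an open set, which contains a rational.
  have hopen : IsOpen (Ioo 0 u ∩ f ⁻¹' Ioi a) :=
    (hf.mono Ioo_subset_Ioi_self).isOpen_inter_preimage isOpen_Ioo isOpen_Ioi
  obtain ⟨y, hy, q, rfl⟩ := Rat.denseRange_cast.inter_open_nonempty _ hopen
    ⟨x, hx, show a < f x from not_le.1 hlt⟩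
  have hle : f q ≤ a := hta (hut hy.1)
  exact absurd hle (not_le.2 hy.2)

theorem measurable_uncurry_pointEval (hα : 0 ≤ α) :
    Measurable fun p : ExtremalSet α × ℝ => pointEval p.2 p.1 := by
  have hcont := continuous_uncurry_primitive hα
  have h (p : ExtremalSet α × ℝ) : pointEval p.2 p.1 =
      limsup (fun q : ℚ => (2 * (q : ℝ))⁻¹ * (p.1.primitive (p.2 + q) - p.1.primitive (p.2 - q)))
        (comap ((↑) : ℚ → ℝ) (𝓝[>] (0 : ℝ))) := by
    rw [pointEval_eq hα]
    refine limsup_nhdsGT_zero_eq_rat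
      (f := fun ε : ℝ => (2 * ε)⁻¹ * (p.1.primitive (p.2 + ε) - p.1.primitive (p.2 - ε))) ?_
    have := p.1.continuous_primitive hα
    refine ContinuousOn.mul (ContinuousOn.inv₀ (by fun_prop) fun x hx => ?_) (by fun_prop)
    exact mul_ne_zero two_ne_zero (ne_of_gt hx)
  simp_rw [h]
  obtain ⟨s, hs⟩ := (comap ((↑) : ℚ → ℝ) (𝓝[>] (0 : ℝ))).exists_antitone_basis
  refine Measurable.limsup' (fun q => ?_) ⟨hs.1, Set.to_countable _⟩ fun _ => to_countable _
  refine measurable_const.mul (Measurable.sub ?_ ?_)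
  · exact (hcont.comp (continuous_fst.prodMk (continuous_snd.add continuous_const))).measurable
  · exact (hcont.comp (continuous_fst.prodMk (continuous_snd.sub continuous_const))).measurable

theorem measurable_pointEval (hα : 0 ≤ α) (x : ℝ) :
    Measurable fun r : ExtremalSet α => pointEval x r := by
  have h : Measurable fun r : ExtremalSet α => (r, x) := measurable_id.prodMk measurable_const
  have h' := Measurable.comp (measurable_uncurry_pointEval hα) h
  simpa only [Function.comp_def] using h'

theorem limsup_mem_Icc {ι : Type*} {l : Filter ι} [l.NeBot] {f : ι → ℝ} {a b : ℝ}
    (h : ∀ᶠ i in l, f i ∈ Icc a b) : limsup f l ∈ Icc a b := by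
  have hb : IsBoundedUnder (· ≤ ·) l f := isBoundedUnder_of_eventually_le (h.mono fun _ h => h.2)
  have hb' : IsBoundedUnder (· ≥ ·) l f := isBoundedUnder_of_eventually_ge (h.mono fun _ h => h.1)
  have h1 : ∀ᶠ i in l, a ≤ f i := h.mono fun _ h => h.1
  have h2 : ∀ᶠ i in l, f i ≤ b := h.mono fun _ h => h.2
  exact ⟨le_limsup_of_frequently_le h1.frequently hb,
    limsup_le_of_le hb'.isCoboundedUnder_le h2⟩

theorem pointEval_mem_Icc (hα : 0 ≤ α) {x : ℝ} (hx : 0 < x) (r : ExtremalSet α) :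
    pointEval x r ∈ Icc 1 (Real.exp α) := by
  rw [pointEval_eq hα]
  refine limsup_mem_Icc ?_
  filter_upwards [Ioo_mem_nhdsGT hx] with ε hε
  have h0 : 0 < 2 * ε := by linarith [hε.1]
  have h1 := r.le_primitive_sub hα (a := x - ε) (b := x + ε) (by linarith [hε.2])
    (by linarith [hε.1])
  have h2 := r.primitive_sub_le hα (a := x - ε) (b := x + ε) (by linarith [hε.1])
  rw [inv_mul_eq_div]
  exact ⟨(le_div_iff₀ h0).2 (by linarith), (div_le_iff₀ h0).2 (by linarith)⟩

/-- The symmetric difference quotient is the mean of the slopes at `ε` and `-ε`, so it converges to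
the derivative. -/
theorem pointEval_eq_of_hasDerivAt (hα : 0 ≤ α) {x d : ℝ} {r : ExtremalSet α}
    (h : HasDerivAt r.primitive d x) : pointEval x r = d := by
  rw [pointEval_eq hα]
  refine Tendsto.limsup_eq ?_
  have h0 : Tendsto (fun ε : ℝ => ε) (𝓝[>] 0) (𝓝[≠] 0) :=
    tendsto_id.mono_left (nhdsWithin_mono _ fun x hx => ne_of_gt hx)
  have hn : Tendsto (fun ε : ℝ => -ε) (𝓝[>] 0) (𝓝[≠] 0) := by
    refine tendsto_nhdsWithin_iff.2 ⟨?_, eventually_mem_nhdsWithin.mono fun x hx => ?_⟩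
    · simpa using (tendsto_id (α := ℝ) (x := 𝓝 0)).neg.mono_left nhdsWithin_le_nhds
    · simpa using ne_of_gt hx
  have h1 := (hasDerivAt_iff_tendsto_slope_zero.1 h).comp h0
  have h2 := (hasDerivAt_iff_tendsto_slope_zero.1 h).comp hn
  have h3 := (h1.add h2).div_const 2
  rw [add_self_div_two] at h3
  refine h3.congr' (eventually_mem_nhdsWithin.mono fun ε hε => ?_)
  have : ε ≠ 0 := ne_of_gt hε
  simp only [Function.comp_apply, smul_eq_mul, ← sub_eq_add_neg]
  field_simp
  ring

theorem ae_hasDerivAt_primitive (hα : 0 ≤ α) (r : ExtremalSet α) :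
    ∀ᵐ x, HasDerivAt r.primitive (pointEval x r) x := by
  filter_upwards [LocallyIntegrable.ae_hasDerivAt_integral (r.locallyIntegrable_indicator hα)] with x hx
  have h : HasDerivAt r.primitive _ x := hx 0
  rwa [pointEval_eq_of_hasDerivAt hα h]

theorem ae_pointEval_eq (hα : 0 ≤ α) (r : ExtremalSet α) :
    ∀ᵐ x, pointEval x r = (Ici (0 : ℝ)).indicator r.toLp x := by
  filter_upwards [LocallyIntegrable.ae_hasDerivAt_integral (r.locallyIntegrable_indicator hα)] with x hx
  exact pointEval_eq_of_hasDerivAt hα (hx 0)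

theorem ae_ae_hasDerivAt_primitive (hα : 0 ≤ α) (μ : Measure (ExtremalSet α)) [SFinite μ] :
    ∀ᵐ x, ∀ᵐ r ∂μ, HasDerivAt r.primitive (pointEval x r) x := by
  -- The quantifiers are exchanged for differentiability alone, whose set of pairs is measurable by
  -- joint continuity; the value of the derivative is identified afterwards.
  have hd : ∀ᵐ x, ∀ᵐ r ∂μ, DifferentiableAt ℝ r.primitive x := by
    rw [← Measure.ae_ae_comm (p := fun (r : ExtremalSet α) (x : ℝ) =>
      DifferentiableAt ℝ r.primitive x) (measurableSet_of_differentiableAt_with_param ℝ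
        (continuous_uncurry_primitive hα))]
    exact ae_of_all _ fun r =>
      (r.ae_hasDerivAt_primitive hα).mono fun x hx => hx.differentiableAt
  filter_upwards [hd] with x hx
  filter_upwards [hx] with r hr
  rw [pointEval_eq_of_hasDerivAt hα hr.hasDerivAt]
  exact hr.hasDerivAt

end ExtremalSet

/-! ### Quadratic mean differentiability and uniqueness of scores. -/

theorem abs_sqrt_sub_sqrt_le {a b : ℝ} (ha : 1 ≤ a) (hb : 1 ≤ b) : |√a - √b| ≤ |a - b| := by
  have ha' : 1 ≤ √a := Real.one_le_sqrt.2 ha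
  have hb' : 1 ≤ √b := Real.one_le_sqrt.2 hb
  have h : a - b = (√a - √b) * (√a + √b) := by
    nlinarith [Real.sq_sqrt (zero_le_one.trans ha), Real.sq_sqrt (zero_le_one.trans hb)]
  rw [h, abs_mul]
  refine le_mul_of_one_le_right (abs_nonneg _) ?_
  rw [abs_of_pos (by linarith)]
  linarith

section QuadraticMean

variable {Ω : Type*} [MeasurableSpace Ω] {ν : Measure Ω}

/-- Differentiation in quadratic mean from pointwise differentiation of the root densities,
by dominated convergence. -/
theorem tendsto_lintegral_sq_sub_div [IsFiniteMeasure ν] {f : ℝ → Ω → ℝ} {f' : Ω → ℝ}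
    {θ₀ C D : ℝ} (hf : ∀ θ, Measurable (f θ)) (hf' : Measurable f')
    (hC : ∀ᶠ h in 𝓝[≠] (0 : ℝ), ∀ z, |f (θ₀ + h) z - f θ₀ z| ≤ C * |h|) (hD : ∀ z, |f' z| ≤ D)
    (hderiv : ∀ᵐ z ∂ν, HasDerivAt (fun θ => f θ z) (f' z) θ₀) :
    Tendsto (fun h => ∫⁻ z, ENNReal.ofReal (((f (θ₀ + h) z - f θ₀ z) / h - f' z) ^ 2) ∂ν)
      (𝓝[≠] 0) (𝓝 0) := by
  have hlim := tendsto_lintegral_filter_of_dominated_convergence (μ := ν) (l := 𝓝[≠] (0 : ℝ))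
    (F := fun h z => ENNReal.ofReal (((f (θ₀ + h) z - f θ₀ z) / h - f' z) ^ 2))
    (f := fun _ => 0) (fun _ => ENNReal.ofReal ((C + D) ^ 2)) ?_ ?_ ?_ ?_
  · simpa using hlim
  · exact Eventually.of_forall fun h => by
      have := hf (θ₀ + h)
      have := hf θ₀
      fun_prop
  · filter_upwards [hC, self_mem_nhdsWithin] with h hh h0
    refine ae_of_all _ fun z => ENNReal.ofReal_le_ofReal (sq_le_sq' ?_ ?_)
    all_goals
      have h1 : |(f (θ₀ + h) z - f θ₀ z) / h| ≤ C := by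
        rw [abs_div]
        exact (div_le_iff₀ (abs_pos.2 h0)).2 (hh z)
      have := abs_le.1 h1
      have := abs_le.1 (hD z)
      linarith
  · rw [lintegral_const]
    exact ENNReal.mul_ne_top ENNReal.ofReal_ne_top (measure_ne_top _ _)
  · filter_upwards [hderiv] with z hz
    have h1 := ((hasDerivAt_iff_tendsto_slope_zero.1 hz).sub_const (f' z)).pow 2
    rw [sub_self, zero_pow two_ne_zero] at h1
    have h2 := ENNReal.tendsto_ofReal h1
    rw [ENNReal.ofReal_zero] at h2
    refine h2.congr fun h => ?_
    rw [smul_eq_mul, inv_mul_eq_div]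

/-- Two score functions agree almost surely. -/
theorem IsScoreAt.ae_eq [SigmaFinite ν] {P : ℝ → Measure Ω} {Θ : Set ℝ} {θ₀ : ℝ} {s t : Ω → ℝ}
    (hs : IsScoreAt P Θ ν θ₀ s) (ht : IsScoreAt P Θ ν θ₀ t) : s =ᵐ[P θ₀] t := by
  have hΘ : θ₀ ∈ Θ := interior_subset hs.mem_interior
  have := hs.isProbabilityMeasure θ₀ hΘ
  have hsm := hs.measurable
  have htm := ht.measurable
  set q : Ω → ℝ := fun z => √((P θ₀).rnDeriv ν z).toReal
  have hqm : Measurable q := by fun_prop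
  have hle (ε : ℝ) (hε : 0 < ε) :
      ∫⁻ z, ENNReal.ofReal (((s z - t z) * q z) ^ 2) ∂ν ≤ ENNReal.ofReal (16 * ε) := by
    obtain ⟨h, ⟨hh1, hh2⟩, h0⟩ := ((((hs.isLittleO ε hε).and (ht.isLittleO ε hε)).filter_mono
      nhdsWithin_le_nhds).and (self_mem_nhdsWithin (a := (0 : ℝ)) (s := {0}ᶜ))).exists
    have hne : h ≠ 0 := h0
    have h0' : 0 < h ^ 2 := by positivity
    set d : Ω → ℝ := fun z => √((P (θ₀ + h)).rnDeriv ν z).toReal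
    have hdm : Measurable d := by fun_prop
    -- The two remainders differ by `h (s - t) q / 2` up to sign, so `((s - t) q)²` is `4 / h²`
    -- times the square of their difference; `(a - b)² ≤ 2 (a² + b²)` makes the constant 8.
    calc ∫⁻ z, ENNReal.ofReal (((s z - t z) * q z) ^ 2) ∂ν
        ≤ ∫⁻ z, ENNReal.ofReal (8 / h ^ 2) *
            (ENNReal.ofReal ((d z - q z - 1 / 2 * h * s z * q z) ^ 2) +
              ENNReal.ofReal ((d z - q z - 1 / 2 * h * t z * q z) ^ 2)) ∂ν := by
          refine lintegral_mono fun z => ?_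
          rw [← ENNReal.ofReal_add (sq_nonneg _) (sq_nonneg _),
            ← ENNReal.ofReal_mul (by positivity)]
          refine ENNReal.ofReal_le_ofReal ?_
          rw [div_mul_eq_mul_div, le_div_iff₀ h0']
          nlinarith [sq_nonneg ((d z - q z - 1 / 2 * h * s z * q z) +
            (d z - q z - 1 / 2 * h * t z * q z))]
      _ ≤ ENNReal.ofReal (8 / h ^ 2) *
            (ENNReal.ofReal (ε * h ^ 2) + ENNReal.ofReal (ε * h ^ 2)) := by
          rw [lintegral_const_mul _ (by fun_prop), lintegral_add_left (by fun_prop)]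
          gcongr
      _ = ENNReal.ofReal (16 * ε) := by
          rw [← ENNReal.ofReal_add (by positivity) (by positivity),
            ← ENNReal.ofReal_mul (by positivity)]
          congr 1
          field_simp
          ring
  have hzero : ∫⁻ z, ENNReal.ofReal (((s z - t z) * q z) ^ 2) ∂ν = 0 := by
    refine le_antisymm (ENNReal.le_of_forall_pos_le_add fun ε hε _ => ?_) zero_le
    refine (hle (ε / 16) (by positivity)).trans ?_
    rw [zero_add, mul_div_cancel₀ _ (by norm_num), ENNReal.ofReal_coe_nnreal]
  rw [lintegral_eq_zero_iff (by fun_prop)] at hzero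
  -- Almost surely for `P θ₀` means `ν`-almost everywhere on the set where the density is nonzero,
  -- and there `q` can be cancelled.
  rw [Filter.EventuallyEq, ← Measure.withDensity_rnDeriv_eq _ _ (hs.absolutelyContinuous θ₀ hΘ),
    ae_withDensity_iff (Measure.measurable_rnDeriv _ _)]
  filter_upwards [hzero, Measure.rnDeriv_lt_top (P θ₀) ν] with z hz hz' hne
  have hq0 : q z ≠ 0 := (Real.sqrt_pos.2 (ENNReal.toReal_pos hne hz'.ne)).ne'
  have h1 : ((s z - t z) * q z) ^ 2 = 0 :=
    le_antisymm (ENNReal.ofReal_eq_zero.1 hz) (sq_nonneg _)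
  exact sub_eq_zero.1 ((mul_eq_zero.1 (pow_eq_zero_iff two_ne_zero |>.1 h1)).resolve_right hq0)

theorem fisherInformation_congr {P : ℝ → Measure Ω} {θ₀ : ℝ} {s t : Ω → ℝ}
    (h : s =ᵐ[P θ₀] t) : fisherInformation P θ₀ s = fisherInformation P θ₀ t :=
  lintegral_congr_ae (h.mono fun z hz => by simp only [hz])

theorem fisherInformation_le_of_abs_le {P : ℝ → Measure Ω} {θ₀ C : ℝ} {s : Ω → ℝ}
    [IsProbabilityMeasure (P θ₀)] (h : ∀ z, |s z| ≤ C) :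
    fisherInformation P θ₀ s ≤ ENNReal.ofReal (C ^ 2) := by
  calc fisherInformation P θ₀ s ≤ ∫⁻ _, ENNReal.ofReal (C ^ 2) ∂(P θ₀) :=
        lintegral_mono fun z => ENNReal.ofReal_le_ofReal (sq_le_sq' (abs_le.1 (h z)).1
          (abs_le.1 (h z)).2)
    _ = _ := by simp

end QuadraticMean

/-! ### The privatized model: density, score and its bound. -/

section Privatized

variable {α : ℝ}

open ExtremalSet

theorem ExtremalSet.IsNormalized.isFiniteMeasure (hα : 0 ≤ α) {μ : Measure (ExtremalSet α)}
    (hμ : IsNormalized μ) : IsFiniteMeasure μ := by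
  have h1 := (ae_restrict_iff' measurableSet_Ici).1 hμ
  -- A single point `x > 0` satisfying the normalization suffices, since `e_x ≥ 1` there. The origin
  -- is excluded because half of each ball around it is cut off.
  have : (ae (volume.restrict (Ioi (0 : ℝ)))).NeBot := by
    rw [ae_restrict_neBot]
    simp
  obtain ⟨x, hx, hx0⟩ :=
    ((ae_restrict_of_ae h1).and (ae_restrict_mem (measurableSet_Ioi (a := (0 : ℝ))))).exists
  refine ⟨lt_of_le_of_lt ?_ ENNReal.one_lt_top⟩
  rw [← hx (mem_Ici.2 (le_of_lt hx0)), ← lintegral_one]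
  exact lintegral_mono fun r => ENNReal.one_le_ofReal.2 (pointEval_mem_Icc hα hx0 r).1

theorem uniformLaw_eq (θ : ℝ) :
    uniformLaw θ = ENNReal.ofReal (1 / θ) • volume.restrict (Icc 0 θ) := by
  have h : (fun x => ENNReal.ofReal ((Icc 0 θ).indicator (fun _ => 1 / θ) x)) =
      (Icc 0 θ).indicator fun _ => ENNReal.ofReal (1 / θ) := by
    ext x
    by_cases hx : x ∈ Icc 0 θ <;> simp [hx]
  rw [uniformLaw, h, withDensity_indicator measurableSet_Icc, withDensity_const]

theorem isProbabilityMeasure_uniformLaw {θ : ℝ} (hθ : 0 < θ) :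
    IsProbabilityMeasure (uniformLaw θ) := by
  constructor
  rw [uniformLaw_eq, Measure.smul_apply, Measure.restrict_apply_univ, Real.volume_Icc, sub_zero,
    smul_eq_mul, ← ENNReal.ofReal_mul (by positivity), one_div_mul_cancel hθ.ne',
    ENNReal.ofReal_one]

theorem ExtremalSet.lintegral_pointEval (hα : 0 ≤ α) (r : ExtremalSet α) {θ : ℝ} (hθ : 0 ≤ θ) :
    ∫⁻ x in Icc 0 θ, ENNReal.ofReal (pointEval x r) = ENNReal.ofReal (r.primitive θ) := by
  rw [← setLIntegral_congr Ioc_ae_eq_Icc, primitive, intervalIntegral.integral_of_le hθ,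
    ofReal_integral_eq_lintegral_ofReal]
  · refine lintegral_congr_ae (ae_restrict_of_ae ?_)
    filter_upwards [r.ae_pointEval_eq hα] with x hx
    rw [hx]
  · exact (r.intervalIntegrable_indicator hα 0 θ).1
  · exact ae_restrict_of_ae ((r.ae_indicator_mem_Icc hα).mono fun x hx => hx.1)

theorem ExtremalSet.measurable_mechanism (hα : 0 ≤ α) (μ : Measure (ExtremalSet α)) [SFinite μ] :
    Measurable (mechanism μ) := by
  refine Measure.measurable_of_measurable_coe _ fun A hA => ?_
  simp_rw [mechanism, withDensity_apply _ hA]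
  exact Measurable.lintegral_prod_left' (μ := μ.restrict A)
    (f := fun p : ExtremalSet α × ℝ => ENNReal.ofReal (pointEval p.2 p.1))
    (measurable_uncurry_pointEval hα).ennreal_ofReal

theorem privatizedLaw_eq_withDensity (hα : 0 ≤ α) (μ : Measure (ExtremalSet α)) [SFinite μ]
    {θ : ℝ} (hθ : 0 < θ) :
    privatizedLaw μ θ = μ.withDensity fun r => ENNReal.ofReal (r.primitive θ / θ) := by
  have := isProbabilityMeasure_uniformLaw hθ
  ext A hA
  rw [privatizedLaw, Measure.bind_apply hA (measurable_mechanism hα μ).aemeasurable]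
  simp_rw [mechanism, withDensity_apply _ hA]
  rw [lintegral_lintegral_swap]
  · refine lintegral_congr fun r => ?_
    rw [uniformLaw_eq, lintegral_smul_measure, r.lintegral_pointEval hα hθ.le, smul_eq_mul,
      ← ENNReal.ofReal_mul (by positivity), one_div_mul_eq_div]
  · exact ((measurable_uncurry_pointEval hα).ennreal_ofReal.comp measurable_swap).aemeasurable

theorem isProbabilityMeasure_privatizedLaw (hα : 0 ≤ α) {μ : Measure (ExtremalSet α)} [SFinite μ]
    (hμ : IsNormalized μ) {θ : ℝ} (hθ : 0 < θ) : IsProbabilityMeasure (privatizedLaw μ θ) := by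
  have := isProbabilityMeasure_uniformLaw hθ
  constructor
  rw [privatizedLaw, Measure.bind_apply .univ (measurable_mechanism hα μ).aemeasurable]
  have h : ∀ᵐ x ∂(uniformLaw θ), mechanism μ x univ = 1 := by
    rw [uniformLaw_eq]
    refine Measure.ae_smul_measure ?_ _
    refine (ae_restrict_iff' measurableSet_Icc).2 ?_
    filter_upwards [(ae_restrict_iff' measurableSet_Ici).1 hμ] with x hx hx0
    rw [mechanism, withDensity_apply _ .univ, Measure.restrict_univ, hx hx0.1]
  rw [lintegral_congr_ae h, lintegral_one, measure_univ]

theorem ExtremalSet.primitive_div_mem_Icc (hα : 0 ≤ α) (r : ExtremalSet α) {θ : ℝ} (hθ : 0 < θ) :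
    r.primitive θ / θ ∈ Icc 1 (Real.exp α) := by
  have h1 := r.le_primitive_sub hα le_rfl hθ.le
  have h2 := r.primitive_sub_le hα hθ.le
  simp only [primitive_zero, sub_zero] at h1 h2
  exact ⟨(le_div_iff₀ hθ).2 (by linarith), (div_le_iff₀ hθ).2 h2⟩

/-- The logarithmic derivative at `θ` of the density `θ ↦ θ⁻¹ ∫_0^θ r(y) dy`. -/
noncomputable def ExtremalSet.score (θ : ℝ) (r : ExtremalSet α) : ℝ :=
  (pointEval θ r / (r.primitive θ / θ) - 1) / θ

theorem ExtremalSet.measurable_score (hα : 0 ≤ α) (θ : ℝ) :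
    Measurable (score (α := α) θ) :=
  (((measurable_pointEval hα θ).div
    ((continuous_primitive_right θ).measurable.div_const θ)).sub_const 1).div_const θ

/-- Both `e` and `p` lie in `[1, exp α]`, so `|e - p| ≤ exp α - 1`, and dividing by `p ≥ 1` does not
increase this. -/
theorem ExtremalSet.abs_score_le (hα : 0 ≤ α) {θ : ℝ} (hθ : 0 < θ) (r : ExtremalSet α) :
    |r.score θ| ≤ (Real.exp α - 1) / θ := by
  obtain ⟨h1, h2⟩ := r.primitive_div_mem_Icc hα hθ
  obtain ⟨h3, h4⟩ := pointEval_mem_Icc hα hθ r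
  rw [score, abs_div, abs_of_pos hθ]
  gcongr
  have hp : 0 < r.primitive θ / θ := by linarith
  rw [div_sub_one hp.ne', abs_div, abs_of_pos hp, div_le_iff₀ hp]
  have h5 : |pointEval θ r - r.primitive θ / θ| ≤ Real.exp α - 1 :=
    abs_le.2 ⟨by linarith, by linarith⟩
  exact h5.trans (le_mul_of_one_le_right (by linarith) h1)

theorem ExtremalSet.hasDerivAt_sqrt_primitive_div (hα : 0 ≤ α) {θ : ℝ} (hθ : 0 < θ)
    {r : ExtremalSet α} (h : HasDerivAt r.primitive (pointEval θ r) θ) :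
    HasDerivAt (fun t => √(r.primitive t / t)) (1 / 2 * r.score θ * √(r.primitive θ / θ)) θ := by
  have hp : 0 < r.primitive θ / θ := zero_lt_one.trans_le (r.primitive_div_mem_Icc hα hθ).1
  have hs : √(r.primitive θ / θ) ≠ 0 := (Real.sqrt_pos.2 hp).ne'
  -- Eliminating the primitive in favour of the root makes the identity of derivatives a rational
  -- one in `q`.
  have hpr : r.primitive θ = √(r.primitive θ / θ) ^ 2 * θ := by
    rw [Real.sq_sqrt hp.le, div_mul_cancel₀ _ hθ.ne']
  have hd : HasDerivAt (fun t => r.primitive t / t)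
      ((pointEval θ r * θ - r.primitive θ * 1) / θ ^ 2) θ := h.div (hasDerivAt_id θ) hθ.ne'
  convert hd.sqrt hp.ne' using 1
  rw [score]
  generalize √(r.primitive θ / θ) = q at *
  rw [hpr]
  field_simp

theorem ExtremalSet.abs_primitive_div_sub_le (hα : 0 ≤ α) {θ h : ℝ} (hθ : 0 < θ)
    (hh : |h| ≤ θ / 2) (r : ExtremalSet α) :
    |r.primitive (θ + h) / (θ + h) - r.primitive θ / θ| ≤ 4 * Real.exp α / θ * |h| := by
  obtain ⟨hl, hr⟩ := abs_le.1 hh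
  have hpos : 0 < θ + h := by linarith
  have h1 := r.abs_primitive_sub_le hα θ (θ + h)
  obtain ⟨h2, h3⟩ := r.primitive_div_mem_Icc hα hθ
  rw [add_sub_cancel_left] at h1
  have heq : r.primitive (θ + h) / (θ + h) - r.primitive θ / θ =
      ((r.primitive (θ + h) - r.primitive θ) - r.primitive θ / θ * h) / (θ + h) := by
    field_simp
    ring
  have h4 : |r.primitive θ / θ * h| ≤ Real.exp α * |h| := by
    rw [abs_mul, abs_of_pos (by linarith)]
    gcongr
  rw [heq, abs_div, abs_of_pos hpos, div_le_iff₀ hpos]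
  refine (abs_sub _ _).trans ((add_le_add h1 h4).trans ?_)
  -- From `|h| ≤ θ / 2`. This factor 2 and the two terms of the numerator give the constant 4.
  have h5 : 1 ≤ 2 / θ * (θ + h) := by
    rw [div_mul_eq_mul_div, le_div_iff₀ hθ]
    linarith
  calc Real.exp α * |h| + Real.exp α * |h| = 2 * Real.exp α * |h| * 1 := by ring
    _ ≤ 2 * Real.exp α * |h| * (2 / θ * (θ + h)) := by gcongr
    _ = _ := by ring

theorem isScoreAt_score (hα : 0 ≤ α) {μ : Measure (ExtremalSet α)} [IsFiniteMeasure μ]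
    (hμ : IsNormalized μ) {θ₀ : ℝ} (hθ₀ : 0 < θ₀)
    (hderiv : ∀ᵐ r ∂μ, HasDerivAt r.primitive (pointEval θ₀ r) θ₀) :
    IsScoreAt (privatizedLaw μ) (Ioi 0) μ θ₀ (score θ₀) where
  isProbabilityMeasure θ hθ := isProbabilityMeasure_privatizedLaw hα hμ hθ
  absolutelyContinuous θ hθ := by
    rw [privatizedLaw_eq_withDensity hα μ hθ]
    exact withDensity_absolutelyContinuous _ _
  mem_interior := by rwa [interior_Ioi]
  measurable := measurable_score hα θ₀
  isLittleO := by
    intro ε hε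
    have hpm (θ : ℝ) : Measurable fun r : ExtremalSet α => r.primitive θ / θ :=
      (continuous_primitive_right θ).measurable.div_const θ
    have hrn {θ : ℝ} (hθ : 0 < θ) :
        ∀ᵐ r ∂μ, ((privatizedLaw μ θ).rnDeriv μ r).toReal = r.primitive θ / θ := by
      rw [privatizedLaw_eq_withDensity hα μ hθ]
      filter_upwards [Measure.rnDeriv_withDensity μ (hpm θ).ennreal_ofReal] with r hr
      rw [hr, ENNReal.toReal_ofReal (zero_le_one.trans (r.primitive_div_mem_Icc hα hθ).1)]
    have hnear : ∀ᶠ h in 𝓝 (0 : ℝ), |h| ≤ θ₀ / 2 := by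
      filter_upwards [Metric.ball_mem_nhds (0 : ℝ) (half_pos hθ₀)] with h hh
      simpa using (mem_ball_zero_iff.1 hh).le
    have hlim := tendsto_lintegral_sq_sub_div (ν := μ) (θ₀ := θ₀)
      (f := fun θ r => √(r.primitive θ / θ))
      (f' := fun r => 1 / 2 * r.score θ₀ * √(r.primitive θ₀ / θ₀))
      (C := 4 * Real.exp α / θ₀) (D := 1 / 2 * ((Real.exp α - 1) / θ₀) * √(Real.exp α))
      (fun θ => (hpm θ).sqrt) (((measurable_score hα θ₀).const_mul _).mul (hpm θ₀).sqrt) ?_ ?_ ?_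
    · have hev := hlim.eventually_le_const (ENNReal.ofReal_pos.2 hε)
      have hev' := eventually_nhdsWithin_iff.1 hev
      filter_upwards [hnear, hev'] with h hh hle
      have hpos : 0 < θ₀ + h := by linarith [(abs_le.1 hh).1]
      -- The limit of slopes only concerns `h ≠ 0`; at `h = 0` the integrand vanishes.
      rcases eq_or_ne h 0 with rfl | h0
      · simp
      calc _ = ∫⁻ r, ENNReal.ofReal (h ^ 2) * ENNReal.ofReal
              (((√(r.primitive (θ₀ + h) / (θ₀ + h)) - √(r.primitive θ₀ / θ₀)) / h -
                1 / 2 * r.score θ₀ * √(r.primitive θ₀ / θ₀)) ^ 2) ∂μ := by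
            refine lintegral_congr_ae ?_
            filter_upwards [hrn hpos, hrn hθ₀] with r h1 h2
            rw [h1, h2, ← ENNReal.ofReal_mul (sq_nonneg h), ← mul_pow]
            congr 2
            field_simp
        _ ≤ ENNReal.ofReal (h ^ 2) * ENNReal.ofReal ε := by
            rw [lintegral_const_mul']
            · gcongr
              exact hle h0
            · exact ENNReal.ofReal_ne_top
        _ = ENNReal.ofReal (ε * h ^ 2) := by
            rw [← ENNReal.ofReal_mul (sq_nonneg h), mul_comm]
    · filter_upwards [nhdsWithin_le_nhds hnear] with h hh r
      have hpos : 0 < θ₀ + h := by linarith [(abs_le.1 hh).1]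
      exact (abs_sqrt_sub_sqrt_le (r.primitive_div_mem_Icc hα hpos).1
        (r.primitive_div_mem_Icc hα hθ₀).1).trans (r.abs_primitive_div_sub_le hα hθ₀ hh)
    · intro r
      rw [abs_mul, abs_mul, abs_of_pos (one_half_pos (α := ℝ)), abs_of_nonneg (Real.sqrt_nonneg _)]
      have := (abs_nonneg _).trans (r.abs_score_le hα hθ₀)
      gcongr
      · exact r.abs_score_le hα hθ₀
      · exact (r.primitive_div_mem_Icc hα hθ₀).2
    · filter_upwards [hderiv] with r hr
      exact hasDerivAt_sqrt_primitive_div hα hθ₀ hr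

end Privatized

theorem mainTheorem7 (α : ℝ) (hα : 0 ≤ α) (μ : Measure (ExtremalSet α))
    (hμ : ExtremalSet.IsNormalized μ) :
    ∀ᵐ θ₀ ∂(volume.restrict (Ioi (0 : ℝ))),
      IsDQMAt (privatizedLaw μ) (Ioi 0) μ θ₀ ∧
      ∀ s : ExtremalSet α → ℝ, IsScoreAt (privatizedLaw μ) (Ioi 0) μ θ₀ s →
        fisherInformation (privatizedLaw μ) θ₀ s
          ≤ ENNReal.ofReal ((Real.exp α - 1) ^ 2 / θ₀ ^ 2) := by
  have := hμ.isFiniteMeasure hα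
  filter_upwards [ae_restrict_of_ae (ExtremalSet.ae_ae_hasDerivAt_primitive hα μ),
    ae_restrict_mem measurableSet_Ioi] with θ₀ hderiv hθ₀
  have hscore := isScoreAt_score hα hμ hθ₀ hderiv
  refine ⟨⟨_, hscore⟩, fun s hs => ?_⟩
  have := isProbabilityMeasure_privatizedLaw hα hμ hθ₀
  rw [fisherInformation_congr (hs.ae_eq hscore), ← div_pow]
  exact fisherInformation_le_of_abs_le fun r => r.abs_score_le hα hθ₀
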